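/- Let $PD(n)$ denote the number of partitions of $n$ with designated summands, that is, of partitions of $n$ in which, for each size that occurs as a part, exactly one of the parts of that size is designated. For complex $a, q$ with $|q|<1$ put $(a;q)_\infty=\prod_{n=1}^{\infty}(1-aq^{n-1})$. Then for every complex $q$ with $|q|<1$ the series below converges and $$\sum_{n=0}^{\infty} PD(3n+1)\,q^n = \frac{(q^3;q^6)_\infty^3\,(q^6;q^6)_\infty^6}{(q;q^2)_\infty^5\,(q^2;q^2)_\infty^8}\left(4q\,\frac{(q;q^2)_\infty^2}{(q^3;q^6)_\infty^6}+\frac{(q^3;q^6)_\infty^3}{(q;q^2)_\infty}\right).$$ -/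

import Mathlib

/-- A partition of `n` with designated summands: a partition of `n` together with, for every
size `i` that occurs among its parts, a choice of one of the `m` parts equal to `i`, where `m` is
the multiplicity of `i` (the equal parts are told apart by their position `0, …, m - 1`). -/
abbrev DesignatedPartition (n : ℕ) : Type :=
  Σ p : n.Partition, ∀ i : {i : ℕ // i ∈ p.parts.toFinset}, Fin (p.parts.count (i : ℕ))

/-- The number of partitions of `n` with designated summands. -/
def PD (n : ℕ) : ℕ := Fintype.card (DesignatedPartition n)

/-- The `q`-shifted factorial `(a; q)_∞ = ∏_{n ≥ 0} (1 - a q ^ n)`, meant for `‖q‖ < 1`. -/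
noncomputable def qPoch (a q : ℂ) : ℂ := ∏' n : ℕ, (1 - a * q ^ n)

/-- The infinite product that defines `(a; q)_∞` converges whenever `‖q‖ < 1`. -/
theorem multipliable_qPoch (a : ℂ) {q : ℂ} (hq : ‖q‖ < 1) :
    Multipliable fun n : ℕ => 1 - a * q ^ n := by
  have h : Summable fun n : ℕ => ‖-(a * q ^ n)‖ := by
    simp only [norm_neg, norm_mul, norm_pow]
    exact (summable_geometric_of_lt_one (norm_nonneg q) hq).mul_left _
  simpa only [sub_eq_add_neg] using multipliable_one_add_of_summable h

open Filter Topology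

/-! Write E_k for `eulerProd (q ^ k)`. The designations for different part sizes are independent, so
a partition is counted with the product of its multiplicities. Hence ∑ PD(n) qⁿ is the product over
i of 1 + x/(1-x)² at x = qⁱ, which is E₆/(E₁E₂E₃) (`hasSum_PD`). Only E₁E₂ in this quotient is not a
function of q³. It factors as φ(-q)ψ(q), where φ(-q) = E₁²/E₂ and ψ(q) = E₂²/E₁ are theta series by
the Jacobi triple product (`hasSum_thetaTerm`). Sorting these series by the index modulo 3 gives
E₁E₂ = a - qb - 2q²c with a, b, c functions of q³ (`eulerProd_mul_eulerProd_sq`). Averaging over q,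
wq, w²q, with w a primitive cube root of unity, isolates the exponents 3n+1. The common denominator
is a product of three conjugates (`eulerProd_cube_root_mul`), and of the numerator only qab + 4q⁴c²
survives; these are the two terms of the result. -/

/-! ### Infinite products of power series and their values -/

theorem PD_eq_sum (n : ℕ) :
    PD n = ∑ p : n.Partition, p.parts.toFinsupp.prod fun _ c => c := by
  unfold PD
  rw [Fintype.card_sigma]
  refine Finset.sum_congr rfl fun p _ => ?_
  rw [Fintype.card_pi]
  simp only [Fintype.card_fin, Finsupp.prod, Multiset.toFinsupp_support, Multiset.toFinsupp_apply]
  exact Finset.prod_coe_sort p.parts.toFinset fun i => p.parts.count i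

/-- The value at `q` of a finite product of power series with natural coefficients. -/
theorem hasSum_coeff_prod_mul_pow {ι : Type*} (G : ι → PowerSeries ℕ) (q : ℂ)
    (hG : ∀ i, Summable fun n => ‖((G i).coeff n : ℂ) * q ^ n‖) (s : Finset ι) :
    (Summable fun n => ‖((∏ i ∈ s, G i).coeff n : ℂ) * q ^ n‖) ∧
      ∑' n, ((∏ i ∈ s, G i).coeff n : ℂ) * q ^ n = ∏ i ∈ s, ∑' n, ((G i).coeff n : ℂ) * q ^ n := by
  classical
  induction s using Finset.induction_on with
  | empty =>
    have h : ∀ n, n ≠ 0 → (((1 : PowerSeries ℕ).coeff n : ℕ) : ℂ) * q ^ n = 0 := fun n hn => by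
      simp [PowerSeries.coeff_one, hn]
    simp only [Finset.prod_empty]
    refine ⟨summable_of_ne_finset_zero (s := {0}) fun n hn => ?_, ?_⟩
    · rw [h n (by simpa using hn), norm_zero]
    · rw [tsum_eq_single 0 h]; simp
  | insert a s ha ih =>
    obtain ⟨hv, hv'⟩ := ih
    have hu := hG a
    rw [Finset.prod_insert ha, Finset.prod_insert ha, ← hv']
    have key : ∀ n, ((G a * ∏ i ∈ s, G i).coeff n : ℂ) * q ^ n =
        ∑ kl ∈ Finset.HasAntidiagonal.antidiagonal n, ((G a).coeff kl.1 : ℂ) * q ^ kl.1 *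
          (((∏ i ∈ s, G i).coeff kl.2 : ℂ) * q ^ kl.2) := fun n => by
      rw [PowerSeries.coeff_mul]
      push_cast
      rw [Finset.sum_mul]
      refine Finset.sum_congr rfl fun kl hkl => ?_
      rw [← Finset.HasAntidiagonal.mem_antidiagonal.1 hkl, pow_add]
      ring
    obtain ⟨u, hu'⟩ : ∃ u : ℕ → ℂ, ∀ n, ((G a).coeff n : ℂ) * q ^ n = u n := ⟨_, fun _ => rfl⟩
    obtain ⟨v, hv''⟩ : ∃ v : ℕ → ℂ, ∀ n, ((∏ i ∈ s, G i).coeff n : ℂ) * q ^ n = v n :=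
      ⟨_, fun _ => rfl⟩
    simp only [hu', hv''] at hu hv key ⊢
    simp only [key]
    exact ⟨summable_norm_sum_mul_antidiagonal_of_summable_norm hu hv,
      (tsum_mul_tsum_eq_tsum_sum_antidiagonal_of_summable_norm hu hv).symm⟩

open scoped PowerSeries.WithPiTopology in
/-- Evaluation of an infinite product of power series with natural coefficients. -/
theorem hasSum_coeff_mul_pow_of_hasProd (G : ℕ → PowerSeries ℕ) (F : PowerSeries ℕ) (q : ℂ)
    (hF : HasProd G F) (h0 : ∀ i, (G i).coeff 0 = 1)
    (hG : ∀ i, Summable fun n => ((G i).coeff n : ℝ) * ‖q‖ ^ n)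
    (hs : Summable fun i => (∑' n, ((G i).coeff n : ℝ) * ‖q‖ ^ n) - 1)
    (hm : Multipliable fun i => ∑' n, ((G i).coeff n : ℂ) * q ^ n) :
    HasSum (fun n => (F.coeff n : ℂ) * q ^ n) (∏' i, ∑' n, ((G i).coeff n : ℂ) * q ^ n) := by
  set g : ℕ → ℝ := fun i => ∑' n, ((G i).coeff n : ℝ) * ‖q‖ ^ n with hg
  have hnn : ∀ (P : PowerSeries ℕ) n, ((P.coeff n : ℝ)) * ‖q‖ ^ n = ‖(P.coeff n : ℂ) * q ^ n‖ :=
    fun P n => by simp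
  have hg1 : ∀ i, 1 ≤ g i := fun i => by
    have := (hG i).le_tsum 0 fun n _ => by positivity
    simpa [h0] using this
  have hfin := hasSum_coeff_prod_mul_pow G q fun i => by simpa only [hnn] using hG i
  have hfinR := hasSum_coeff_prod_mul_pow G (‖q‖ : ℂ) fun i => by
    simpa using hG i
  have hR : ∀ s : Finset ℕ, ∑' n, ((∏ i ∈ s, G i).coeff n : ℝ) * ‖q‖ ^ n = ∏ i ∈ s, g i := by
    intro s
    have := (hfinR s).2
    exact_mod_cast this
  -- ℕ is discrete, so convergence of a coefficient means that it is eventually constant.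
  have hcoe : ∀ n, ∀ᶠ s in atTop, (∏ i ∈ s, G i).coeff n = F.coeff n := by
    intro n
    have h1 := (PowerSeries.WithPiTopology.tendsto_iff_coeff_tendsto _ _ _ _).1 hF n
    rw [nhds_discrete, tendsto_pure] at h1
    exact h1
  -- By 1 + x ≤ eˣ the majorants of all finite products share one bound, which makes the series of
  -- `F` absolutely convergent.
  have hbound : ∀ s : Finset ℕ, ∏ i ∈ s, g i ≤ Real.exp (∑' i, (g i - 1)) := by
    intro s
    calc ∏ i ∈ s, g i ≤ ∏ i ∈ s, Real.exp (g i - 1) := by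
          refine Finset.prod_le_prod (fun i _ => by linarith [hg1 i]) fun i _ => ?_
          linarith [Real.add_one_le_exp (g i - 1)]
      _ = Real.exp (∑ i ∈ s, (g i - 1)) := (Real.exp_sum _ _).symm
      _ ≤ _ := Real.exp_le_exp.2 (hs.sum_le_tsum _ fun i _ => by linarith [hg1 i])
  have hsumF : Summable fun n => (F.coeff n : ℝ) * ‖q‖ ^ n := by
    refine summable_of_sum_le (c := Real.exp (∑' i, (g i - 1))) (fun n => by positivity) fun u => ?_
    obtain ⟨s, hs'⟩ := (((Filter.eventually_all_finset u).2 fun n _ => hcoe n)).exists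
    calc ∑ n ∈ u, (F.coeff n : ℝ) * ‖q‖ ^ n
        = ∑ n ∈ u, ((∏ i ∈ s, G i).coeff n : ℝ) * ‖q‖ ^ n :=
          Finset.sum_congr rfl fun n hn => by rw [hs' n hn]
      _ ≤ ∑' n, ((∏ i ∈ s, G i).coeff n : ℝ) * ‖q‖ ^ n := by
          refine Summable.sum_le_tsum _ (fun n _ => by positivity) ?_
          simpa only [hnn] using (hfin s).1
      _ ≤ _ := (hR s).trans_le (hbound s)
  -- Further factors have constant term 1 and natural coefficients, so coefficients can only grow.
  -- Thus `F` dominates every finite product, and dominated convergence applies.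
  have hmono : ∀ n (s : Finset ℕ), (∏ i ∈ s, G i).coeff n ≤ F.coeff n := by
    intro n s
    obtain ⟨t, ht1, ht2⟩ := ((hcoe n).and (eventually_ge_atTop s)).exists
    rw [← ht1, ← Finset.prod_sdiff ht2, PowerSeries.coeff_mul]
    have h1 : (∏ i ∈ t \ s, G i).coeff 0 = 1 := by
      rw [PowerSeries.coeff_zero_eq_constantCoeff_apply, map_prod]
      exact Finset.prod_eq_one fun i _ => by
        rw [← PowerSeries.coeff_zero_eq_constantCoeff_apply, h0]
    calc _ = (∏ i ∈ t \ s, G i).coeff 0 * (∏ i ∈ s, G i).coeff n := by rw [h1, one_mul]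
      _ ≤ _ := Finset.single_le_sum (f := fun kl : ℕ × ℕ => (∏ i ∈ t \ s, G i).coeff kl.1 *
          (∏ i ∈ s, G i).coeff kl.2) (fun _ _ => Nat.zero_le _) (a := (0, n)) (by simp)
  have hlim : Tendsto (fun s : Finset ℕ => ∑' n, ((∏ i ∈ s, G i).coeff n : ℂ) * q ^ n) atTop
      (𝓝 (∑' n, (F.coeff n : ℂ) * q ^ n)) := by
    refine tendsto_tsum_of_dominated_convergence hsumF (fun n => ?_) (.of_forall fun s n => ?_)
    · exact tendsto_const_nhds.congr' ((hcoe n).mono fun s h => by simp only [h])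
    · rw [← hnn]
      gcongr
      exact_mod_cast hmono n s
  simp only [(hfin _).2] at hlim
  rw [hm.hasProd.unique hlim]
  refine (Summable.of_norm ?_).hasSum
  simpa only [hnn] using hsumF

theorem one_sub_pow_ne_zero {q : ℂ} (hq : ‖q‖ < 1) {n : ℕ} (hn : n ≠ 0) : 1 - q ^ n ≠ 0 := by
  intro h
  have h1 : ‖q ^ n‖ = 1 := by
    rw [show q ^ n = 1 by linear_combination -h, norm_one]
  rw [norm_pow] at h1
  exact (pow_lt_one₀ (norm_nonneg q) hq hn).ne h1

theorem qPoch_ne_zero {a q : ℂ} (hq : ‖q‖ < 1) (ha : ‖a‖ < 1) : qPoch a q ≠ 0 := by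
  unfold qPoch
  simp only [sub_eq_add_neg]
  refine tprod_one_add_ne_zero_of_summable (fun n h => ?_) ?_
  · have h1 : ‖a * q ^ n‖ = 1 := by
      rw [show a * q ^ n = 1 by linear_combination -h, norm_one]
    rw [norm_mul, norm_pow] at h1
    nlinarith [norm_nonneg a, norm_nonneg q, pow_le_one₀ (norm_nonneg q) hq.le (n := n),
      pow_nonneg (norm_nonneg q) n]
  · simp only [norm_neg, norm_mul, norm_pow]
    exact (summable_geometric_of_lt_one (norm_nonneg q) hq).mul_left _

/-! ### The generating function of `PD` -/

/-- The power series `1 + ∑ m X ^ (i m)`, which accounts for the parts of size `i`. -/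
noncomputable def designatedSeries (i : ℕ) : PowerSeries ℕ :=
  PowerSeries.mk fun n => if n = 0 then 1 else if i ∣ n then n / i else 0

open scoped PowerSeries.WithPiTopology in
theorem hasProd_designatedSeries :
    HasProd (fun i => designatedSeries (i + 1)) (PowerSeries.mk PD) := by
  have h := Nat.Partition.hasProd_genFun (R := ℕ) fun _ c => c
  have h1 : Nat.Partition.genFun (R := ℕ) (fun _ c => c) = PowerSeries.mk PD := by
    ext n
    rw [Nat.Partition.coeff_genFun, PowerSeries.coeff_mk, PD_eq_sum]
  rw [h1] at h
  convert h using 2 with i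
  ext n
  rw [map_add, (Nat.Partition.summable_genFun_term (fun _ c => c) i).map_tsum _
    (PowerSeries.WithPiTopology.continuous_coeff ℕ n)]
  simp only [map_smul, PowerSeries.coeff_X_pow, designatedSeries, PowerSeries.coeff_mk,
    PowerSeries.coeff_one]
  by_cases hn : n = 0
  · subst hn
    simp
  · rw [if_neg hn, if_neg hn, zero_add]
    by_cases hd : i + 1 ∣ n
    · obtain ⟨k, rfl⟩ := hd
      -- The index j of the sum stands for multiplicity j + 1.
      rw [if_pos ⟨k, rfl⟩, tsum_eq_single (k - 1)]
      · have hk : k - 1 + 1 = k := Nat.sub_add_cancel (Nat.pos_of_ne_zero (by aesop))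
        simp [hk]
      · intro j hj
        have : (i + 1) * k ≠ (i + 1) * (j + 1) := fun h => hj (by
          have := Nat.eq_of_mul_eq_mul_left (Nat.succ_pos i) h
          omega)
        simp only [if_neg this, smul_zero]
    · rw [if_neg hd]
      have : ∀ j, n ≠ (i + 1) * (j + 1) := fun j h => hd ⟨_, h⟩
      simp [this]

/-- This is ∑ k xᵏ = x/(1-x)² at x = q^(i+1). It is needed over ℂ at `q` for the value and over ℝ at
`‖q‖` for the majorant. -/
theorem hasSum_designatedSeries {𝕜 : Type*} [RCLike 𝕜] (i : ℕ) {q : 𝕜} (hq : ‖q‖ < 1) :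
    HasSum (fun n => ((designatedSeries (i + 1)).coeff n : 𝕜) * q ^ n)
      (1 + q ^ (i + 1) / (1 - q ^ (i + 1)) ^ 2) := by
  have hx : ‖q ^ (i + 1)‖ < 1 := by
    rw [norm_pow]; exact pow_lt_one₀ (norm_nonneg q) hq (Nat.succ_ne_zero i)
  have h1 := hasSum_coe_mul_geometric_of_norm_lt_one hx
  have h2 : HasSum (fun n : ℕ => (if n = 0 then (1 : 𝕜) else 0) + 
      if i + 1 ∣ n then ((n / (i + 1) : ℕ) : 𝕜) * q ^ n else 0)
      (1 + q ^ (i + 1) / (1 - q ^ (i + 1)) ^ 2) := by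
    refine (hasSum_ite_eq 0 1).add ?_
    have hinj : Function.Injective fun k : ℕ => (i + 1) * k :=
      mul_right_injective₀ (Nat.succ_ne_zero i)
    rw [← hinj.hasSum_iff]
    · convert h1 using 2 with k
      simp [pow_mul]
    · intro n hn
      exact if_neg fun ⟨k, hk⟩ => hn ⟨k, hk.symm⟩
  convert h2 using 2 with n
  simp only [designatedSeries, PowerSeries.coeff_mk]
  by_cases hn : n = 0
  · simp [hn]
  · by_cases hd : i + 1 ∣ n <;> simp [hn, hd]

theorem summable_pow_div_one_sub_pow_sq {r : ℝ} (hr0 : 0 ≤ r) (hr : r < 1) :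
    Summable fun i : ℕ => r ^ (i + 1) / (1 - r ^ (i + 1)) ^ 2 := by
  refine Summable.of_nonneg_of_le (f := fun i : ℕ => r ^ i / (1 - r) ^ 2) (fun i => by positivity)
    (fun i => ?_) ((summable_geometric_of_lt_one hr0 hr).div_const _)
  have h1 : r ^ (i + 1) ≤ r := pow_le_of_le_one hr0 hr.le (Nat.succ_ne_zero i)
  have h2 : r ^ (i + 1) ≤ r ^ i := pow_le_pow_of_le_one hr0 hr.le (Nat.le_succ i)
  have h3 : 0 < 1 - r := by linarith
  gcongr

/-- The generating function of the partitions with designated summands. -/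
theorem hasSum_PD {q : ℂ} (hq : ‖q‖ < 1) :
    HasSum (fun n => (PD n : ℂ) * q ^ n)
      (qPoch (q ^ 6) (q ^ 6) / (qPoch q q * qPoch (q ^ 2) (q ^ 2) * qPoch (q ^ 3) (q ^ 3))) := by
  have hk : ∀ k : ℕ, k ≠ 0 → ‖q ^ k‖ < 1 := fun k hk => by
    rw [norm_pow]; exact pow_lt_one₀ (norm_nonneg q) hq hk
  have hp : ∀ k : ℕ, k ≠ 0 → HasProd (fun i : ℕ => 1 - q ^ k * (q ^ k) ^ i)
      (qPoch (q ^ k) (q ^ k)) := fun k h => (multipliable_qPoch _ (hk k h)).hasProd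
  have hn : ∀ k : ℕ, k ≠ 0 → qPoch (q ^ k) (q ^ k) ≠ 0 := fun k h => qPoch_ne_zero (hk k h) (hk k h)
  -- Factor by factor: 1 + x/(1-x)² = (1-x+x²)/(1-x)² = (1-x⁶)/((1-x)(1-x²)(1-x³)).
  have hprod : HasProd (fun i : ℕ => 1 + q ^ (i + 1) / (1 - q ^ (i + 1)) ^ 2)
      (qPoch (q ^ 6) (q ^ 6) / (qPoch q q * qPoch (q ^ 2) (q ^ 2) * qPoch (q ^ 3) (q ^ 3))) := by
    have h123 := ((hp 1 one_ne_zero).mul (hp 2 two_ne_zero)).mul (hp 3 three_ne_zero)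
    have hne := mul_ne_zero (mul_ne_zero (hn 1 one_ne_zero) (hn 2 two_ne_zero))
      (hn 3 three_ne_zero)
    have h := (hp 6 (by norm_num)).div₀ h123 hne
    simp only [pow_one] at h
    refine Eq.subst (motive := fun f => HasProd f _) (funext fun i => ?_) h
    symm
    have e : ∀ k : ℕ, q ^ k * (q ^ k) ^ i = (q ^ (i + 1)) ^ k := fun k => by ring
    have e1 : q * q ^ i = q ^ (i + 1) := by ring
    rw [e, e, e, e1]
    have n1 := one_sub_pow_ne_zero hq (Nat.succ_ne_zero i)
    have n2 := one_sub_pow_ne_zero (hk (i + 1) (Nat.succ_ne_zero i)) two_ne_zero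
    have n3 := one_sub_pow_ne_zero (hk (i + 1) (Nat.succ_ne_zero i)) three_ne_zero
    simp only [Nat.succ_eq_add_one] at n1
    generalize q ^ (i + 1) = x at *
    field_simp
    ring
  have hr : ‖‖q‖‖ < 1 := by simpa using hq
  have hR := fun i => hasSum_designatedSeries (𝕜 := ℝ) i hr
  have hC := fun i => hasSum_designatedSeries (𝕜 := ℂ) i hq
  have := hasSum_coeff_mul_pow_of_hasProd (fun i => designatedSeries (i + 1)) _ q
    hasProd_designatedSeries (fun i => by simp [designatedSeries]) (fun i => (hR i).summable)
    (by
      simp only [(hR _).tsum_eq, add_sub_cancel_left]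
      exact summable_pow_div_one_sub_pow_sq (norm_nonneg q) hq)
    (by simpa only [(hC _).tsum_eq] using hprod.multipliable)
  simpa only [(hC _).tsum_eq, hprod.tprod_eq, PowerSeries.coeff_mk] using this

/-! ### The Jacobi triple product -/

/-- The finite product `(q; q)_n`. -/
noncomputable def qFactorial (q : ℂ) (n : ℕ) : ℂ := ∏ k ∈ Finset.range n, (1 - q * q ^ k)

/-- The reciprocal of `(q; q)_m`, extended by zero to negative `m`. -/
noncomputable def qFactorialInv (q : ℂ) (m : ℤ) : ℂ :=
  if m < 0 then 0 else (qFactorial q m.toNat)⁻¹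

theorem tendsto_qFactorial {q : ℂ} (hq : ‖q‖ < 1) :
    Tendsto (qFactorial q) atTop (𝓝 (qPoch q q)) :=
  (multipliable_qPoch q hq).hasProd.tendsto_prod_nat

theorem qFactorialInv_natCast (q : ℂ) (n : ℕ) : qFactorialInv q n = (qFactorial q n)⁻¹ := by
  simp [qFactorialInv]

/-- Extension by zero keeps the recursion valid for all integers: at m = 0 the factor 1 - q⁰
vanishes. The finite triple product then needs no boundary cases. -/
theorem qFactorialInv_sub_one {q : ℂ} (hq : ‖q‖ < 1) (m : ℤ) :
    qFactorialInv q (m - 1) = (1 - q ^ m) * qFactorialInv q m := by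
  rcases lt_trichotomy m 0 with h | rfl | h
  · simp [qFactorialInv, h, show m - 1 < 0 by omega]
  · simp [qFactorialInv]
  · obtain ⟨n, rfl⟩ : ∃ n : ℕ, m = (n : ℤ) + 1 := ⟨(m - 1).toNat, by omega⟩
    rw [add_sub_cancel_right, ← Nat.cast_succ, qFactorialInv_natCast, qFactorialInv_natCast,
      zpow_natCast]
    have h1 := one_sub_pow_ne_zero hq (Nat.succ_ne_zero n)
    have h2 : qFactorial q n.succ = qFactorial q n * (1 - q ^ n.succ) := by
      rw [qFactorial, Finset.prod_range_succ, ← pow_succ']; rfl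
    rw [h2, mul_inv]
    field_simp

theorem exists_norm_qFactorialInv_le {q : ℂ} (hq : ‖q‖ < 1) :
    ∃ C : ℝ, 0 ≤ C ∧ ∀ m, ‖qFactorialInv q m‖ ≤ C := by
  have h := ((tendsto_qFactorial hq).inv₀ (qPoch_ne_zero hq hq)).norm
  obtain ⟨C, hC⟩ := h.bddAbove_range
  have hC0 : 0 ≤ C := (norm_nonneg _).trans (hC ⟨0, rfl⟩)
  refine ⟨C, hC0, fun m => ?_⟩
  unfold qFactorialInv
  split_ifs with hm
  · simpa using hC0
  · exact hC ⟨m.toNat, rfl⟩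

/-- The general term of the theta series. -/
noncomputable def thetaTerm (z q : ℂ) (n : ℤ) : ℂ := (-z) ^ n * q ^ (n * (n - 1) / 2)

theorem mul_sub_one_ediv_two_succ (n : ℤ) : (n + 1) * (n + 1 - 1) / 2 = n * (n - 1) / 2 + n := by
  rw [show (n + 1) * (n + 1 - 1) = n * (n - 1) + n * 2 by ring,
    Int.add_mul_ediv_right _ _ two_ne_zero]

theorem thetaTerm_add_one {z q : ℂ} (hz : z ≠ 0) (hq : q ≠ 0) (n : ℤ) :
    thetaTerm z q (n + 1) = -z * q ^ n * thetaTerm z q n := by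
  unfold thetaTerm
  rw [mul_sub_one_ediv_two_succ, zpow_add₀ hq, zpow_add_one₀ (neg_ne_zero.2 hz)]
  ring

theorem thetaTerm_sub_one {z q : ℂ} (hz : z ≠ 0) (hq : q ≠ 0) (n : ℤ) :
    thetaTerm z q (n - 1) * (z * q ^ (n - 1)) = - thetaTerm z q n := by
  have := thetaTerm_add_one hz hq (n - 1)
  rw [sub_add_cancel] at this
  rw [this]; ring

theorem summable_norm_thetaTerm_nat {z q : ℂ} (hz : z ≠ 0) (hq0 : q ≠ 0) (hq : ‖q‖ < 1) :
    Summable fun n : ℕ => ‖thetaTerm z q n‖ := by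
  refine summable_of_ratio_test_tendsto_lt_one (l := 0) one_pos ?_ ?_
  · refine .of_forall fun n => ?_
    simp only [thetaTerm, ne_eq, norm_eq_zero]
    exact mul_ne_zero (zpow_ne_zero _ (neg_ne_zero.2 hz)) (zpow_ne_zero _ hq0)
  · have h1 : ∀ n : ℕ, ‖‖thetaTerm z q (n + 1 : ℕ)‖‖ / ‖‖thetaTerm z q n‖‖ = ‖z‖ * ‖q‖ ^ n := by
      intro n
      have h0 : thetaTerm z q n ≠ 0 :=
        mul_ne_zero (zpow_ne_zero _ (neg_ne_zero.2 hz)) (zpow_ne_zero _ hq0)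
      rw [norm_norm, norm_norm, Nat.cast_succ, thetaTerm_add_one hz hq0, norm_mul,
        mul_div_cancel_right₀ _ (norm_ne_zero_iff.2 h0), norm_mul, norm_neg, zpow_natCast, norm_pow]
    simp only [h1]
    simpa using (tendsto_pow_atTop_nhds_zero_of_lt_one (norm_nonneg q) hq).const_mul ‖z‖

/-- Reflecting n exchanges z and q/z, which reduces convergence over ℤ to convergence over ℕ. -/
theorem thetaTerm_neg {q : ℂ} (hq : q ≠ 0) (z : ℂ) (n : ℤ) :
    thetaTerm z q (-n) = thetaTerm (q / z) q n := by
  have h : -n * (-n - 1) / 2 = n * (n - 1) / 2 + n := by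
    rw [← mul_sub_one_ediv_two_succ]; congr 1; ring
  unfold thetaTerm
  rw [h, zpow_add₀ hq, neg_div', neg_eq_neg_one_mul q, neg_eq_neg_one_mul z, div_zpow,
    mul_zpow, mul_zpow, zpow_neg, zpow_neg]
  have : ((-1 : ℂ) ^ n)⁻¹ = (-1) ^ n := by rw [← inv_zpow]; norm_num
  rw [this, div_eq_mul_inv]
  ring

theorem summable_norm_thetaTerm {z q : ℂ} (hz : z ≠ 0) (hq0 : q ≠ 0) (hq : ‖q‖ < 1) :
    Summable fun n : ℤ => ‖thetaTerm z q n‖ := by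
  refine Summable.of_nat_of_neg (summable_norm_thetaTerm_nat hz hq0 hq) ?_
  simp only [thetaTerm_neg hq0]
  exact summable_norm_thetaTerm_nat (div_ne_zero hq0 hz) hq0 hq

theorem HasSum.of_eq {ι : Type*} {f g : ι → ℂ} {a b : ℂ} (h : HasSum f a) (hf : ∀ i, g i = f i)
    (ha : b = a) : HasSum g b := by
  rw [funext hf, ha]; exact h

/-- The finite form of the Jacobi triple product. -/
theorem hasSum_thetaTerm_mul_qFactorial {z q : ℂ} (hz : z ≠ 0) (hq0 : q ≠ 0) (hq : ‖q‖ < 1)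
    (N : ℕ) :
    HasSum (fun n : ℤ => thetaTerm z q n *
        (qFactorial q (2 * N) * qFactorialInv q (N - n) * qFactorialInv q (N + n)))
      (∏ k ∈ Finset.range N, (1 - z * q ^ k) * (1 - q / z * q ^ k)) := by
  induction N with
  | zero =>
    rw [Finset.range_zero, Finset.prod_empty]
    convert hasSum_ite_eq (0 : ℤ) (1 : ℂ) using 2 with n
    rcases lt_trichotomy n 0 with h | rfl | h
    · simp [qFactorialInv, h, h.ne]
    · simp [thetaTerm, qFactorial, qFactorialInv]
    · simp [qFactorialInv, h, h.ne']
  | succ N ih =>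
    set F : ℤ → ℂ := fun n => thetaTerm z q n *
        (qFactorial q (2 * N) * qFactorialInv q (N - n) * qFactorialInv q (N + n)) with hF
    have h1 := (Equiv.hasSum_iff (Equiv.subRight (1 : ℤ))).2 ih
    have h2 := (Equiv.hasSum_iff (Equiv.addRight (1 : ℤ))).2 ih
    -- The new factor (1 - zq^N)(1 - (q/z)q^N) expands to 1 + q^(2N+1) - zq^N - (q/z)q^N. Shifting
    -- the summation index in the last two terms reduces the step to an identity between
    -- coefficients at each n.
    have h := ((ih.mul_left (1 + q ^ (2 * N + 1))).sub (h1.mul_left (z * q ^ N))).sub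
      (h2.mul_left (q / z * q ^ N))
    rw [Finset.prod_range_succ]
    refine h.of_eq (fun n => ?_) ?_
    · push_cast
      simp only [Function.comp_apply, Equiv.subRight_apply, Equiv.coe_addRight, hF]
      have a1 := qFactorialInv_sub_one hq (N + 1 - n)
      have a2 := qFactorialInv_sub_one hq (N + 1 - n - 1)
      have b1 := qFactorialInv_sub_one hq (N + 1 + n)
      have b2 := qFactorialInv_sub_one hq (N + 1 + n - 1)
      rw [show (N : ℤ) - n = N + 1 - n - 1 by ring, show (N : ℤ) + n = N + 1 + n - 1 by ring,
        show (N : ℤ) - (n - 1) = N + 1 - n by ring,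
        show (N : ℤ) - (n + 1) = N + 1 - n - 1 - 1 by ring,
        show (N : ℤ) + (n - 1) = N + 1 + n - 1 - 1 by ring,
        show (N : ℤ) + (n + 1) = N + 1 + n by ring,
        a2, b2, a1, b1]
      have hf : qFactorial q (2 * (N + 1)) =
          qFactorial q (2 * N) * (1 - q ^ (2 * N + 1)) * (1 - q ^ (2 * N + 2)) := by
        rw [qFactorial, show 2 * (N + 1) = 2 * N + 1 + 1 by ring, Finset.prod_range_succ,
          Finset.prod_range_succ, qFactorial]
        ring
      have t1 := thetaTerm_sub_one hz hq0 n
      have t2 := thetaTerm_add_one hz hq0 n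
      have t1' : z * thetaTerm z q (n - 1) = - thetaTerm z q n * q / q ^ n := by
        rw [← t1, zpow_sub_one₀ hq0]
        have := zpow_ne_zero n hq0
        field_simp
      have hA : q ^ ((N : ℤ) + 1 - n) = q ^ (N + 1) / q ^ n := by
        rw [zpow_sub₀ hq0]; norm_cast
      have hB : q ^ ((N : ℤ) + 1 + n) = q ^ (N + 1) * q ^ n := by
        rw [zpow_add₀ hq0]; norm_cast
      have hA' : q ^ ((N : ℤ) + 1 - n - 1) = q ^ N / q ^ n := by
        rw [zpow_sub_one₀ hq0, hA, pow_succ]; field_simp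
      have hB' : q ^ ((N : ℤ) + 1 + n - 1) = q ^ N * q ^ n := by
        rw [zpow_sub_one₀ hq0, hB, pow_succ]; field_simp
      rw [hA, hB, hA', hB', hf, t2]
      generalize qFactorialInv q (N + 1 - n) = R
      generalize qFactorialInv q (N + 1 + n) = S
      have hX := zpow_ne_zero n hq0
      generalize qFactorial q (2 * N) = Q
      generalize q ^ n = X at *
      generalize thetaTerm z q n = T at *
      simp only [two_mul, pow_add, pow_one]
      generalize q ^ N = Y
      rw [show ∀ a b : ℂ, z * Y * (thetaTerm z q (n - 1) * (a * b)) =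
        Y * a * b * (z * thetaTerm z q (n - 1)) by intros; ring, t1']
      field_simp
      ring
    · simp only [two_mul, pow_add, pow_one]
      generalize ∏ k ∈ Finset.range N, (1 - z * q ^ k) * (1 - q / z * q ^ k) = P
      field_simp
      ring

/-- The Jacobi triple product. -/
theorem hasSum_thetaTerm {z q : ℂ} (hz : z ≠ 0) (hq0 : q ≠ 0) (hq : ‖q‖ < 1) :
    HasSum (thetaTerm z q) (qPoch z q * qPoch (q / z) q * qPoch q q) := by
  obtain ⟨C, hC0, hC⟩ := exists_norm_qFactorialInv_le hq
  have hE := tendsto_qFactorial hq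
  have hne := qPoch_ne_zero hq hq
  obtain ⟨D, hD⟩ := hE.norm.bddAbove_range
  have hinv : Tendsto (fun n : ℕ => qFactorialInv q n) atTop (𝓝 (qPoch q q)⁻¹) := by
    simp only [qFactorialInv_natCast]
    exact hE.inv₀ hne
  have hinvZ : ∀ n : ℤ, Tendsto (fun N : ℕ => qFactorialInv q (N + n)) atTop
      (𝓝 (qPoch q q)⁻¹) := by
    intro n
    have h1 : Tendsto (fun N : ℕ => (N + n).toNat) atTop atTop :=
      tendsto_atTop.2 fun b => (eventually_ge_atTop (b + n.natAbs)).mono fun N hN => by omega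
    refine (hinv.comp h1).congr' ?_
    filter_upwards [eventually_ge_atTop n.natAbs] with N hN
    simp only [Function.comp_apply]
    rw [Int.toNat_of_nonneg (by omega)]
  -- For fixed n the coefficient tends to 1/(q; q)_∞, and it is bounded uniformly in N and n, so the
  -- limit passes through the sum.
  have hlim : Tendsto (fun N : ℕ => ∑' n : ℤ, thetaTerm z q n *
        (qFactorial q (2 * N) * qFactorialInv q (N - n) * qFactorialInv q (N + n))) atTop
      (𝓝 (∑' n : ℤ, thetaTerm z q n * (qPoch q q)⁻¹)) := by
    refine tendsto_tsum_of_dominated_convergence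
      ((summable_norm_thetaTerm hz hq0 hq).mul_right (D * C * C)) (fun n => ?_)
      (.of_forall fun N n => ?_)
    · refine Tendsto.const_mul _ ?_
      have h2 : Tendsto (fun N : ℕ => 2 * N) atTop atTop :=
        tendsto_atTop.2 fun b => (eventually_ge_atTop b).mono fun N hN => by omega
      have := ((hE.comp h2).mul (hinvZ (-n))).mul (hinvZ n)
      rwa [mul_inv_cancel₀ hne, one_mul] at this
    · rw [norm_mul, norm_mul, norm_mul]
      have hDN : ‖qFactorial q (2 * N)‖ ≤ D := hD ⟨2 * N, rfl⟩
      have hD0 : 0 ≤ D := (norm_nonneg _).trans hDN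
      gcongr <;> apply hC
  simp only [(hasSum_thetaTerm_mul_qFactorial hz hq0 hq _).tsum_eq] at hlim
  have hprod : Tendsto (fun N => ∏ k ∈ Finset.range N, (1 - z * q ^ k) * (1 - q / z * q ^ k)) atTop
      (𝓝 (qPoch z q * qPoch (q / z) q)) :=
    ((multipliable_qPoch z hq).hasProd.mul
      (multipliable_qPoch (q / z) hq).hasProd).tendsto_prod_nat
  have h := tendsto_nhds_unique hprod hlim
  rw [tsum_mul_right] at h
  rw [h, inv_mul_cancel_right₀ hne]
  exact (summable_norm_thetaTerm hz hq0 hq).of_norm.hasSum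

/-! ### Splitting Euler products -/

/-- Euler's product `(q; q)_∞`. -/
noncomputable def eulerProd (q : ℂ) : ℂ := qPoch q q

theorem eulerProd_ne_zero {q : ℂ} (hq : ‖q‖ < 1) : eulerProd q ≠ 0 := qPoch_ne_zero hq hq

theorem norm_pow_lt_one {q : ℂ} (hq : ‖q‖ < 1) {k : ℕ} (hk : k ≠ 0) : ‖q ^ k‖ < 1 := by
  rw [norm_pow]; exact pow_lt_one₀ (norm_nonneg q) hq hk

theorem eulerProd_pow_ne_zero {q : ℂ} (hq : ‖q‖ < 1) {k : ℕ} (hk : k ≠ 0) :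
    eulerProd (q ^ k) ≠ 0 := eulerProd_ne_zero (norm_pow_lt_one hq hk)

/-- Splitting the product `(a; q)_∞` by residue classes. -/
theorem qPoch_eq_prod_range (a : ℂ) {q : ℂ} (hq : ‖q‖ < 1) {k : ℕ} (hk : k ≠ 0) :
    qPoch a q = ∏ i ∈ Finset.range k, qPoch (a * q ^ i) (q ^ k) := by
  have h1 : ∀ N, ∏ n ∈ Finset.range (k * N), (1 - a * q ^ n) =
      ∏ i ∈ Finset.range k, ∏ m ∈ Finset.range N, (1 - a * q ^ i * (q ^ k) ^ m) := by
    intro N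
    induction N with
    | zero => simp
    | succ N ih =>
      rw [Nat.mul_succ, Finset.prod_range_add, ih, ← Finset.prod_mul_distrib]
      refine Finset.prod_congr rfl fun i _ => ?_
      rw [Finset.prod_range_succ, pow_add, pow_mul]
      ring
  have h2 : Tendsto (fun N => k * N) atTop atTop :=
    tendsto_id.const_mul_atTop' (Nat.pos_of_ne_zero hk)
  have h3 := (multipliable_qPoch a hq).hasProd.tendsto_prod_nat.comp h2
  refine tendsto_nhds_unique h3 ?_
  simp only [Function.comp_def, h1]
  exact tendsto_finsetProd _ fun i _ =>
    (multipliable_qPoch (a * q ^ i) (norm_pow_lt_one hq hk)).hasProd.tendsto_prod_nat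

theorem qPoch_eq_one_sub_mul (a : ℂ) {q : ℂ} (hq : ‖q‖ < 1) :
    qPoch a q = (1 - a) * qPoch (a * q) q := by
  have h1 := (multipliable_qPoch a hq).hasProd.tendsto_prod_nat.comp (tendsto_add_atTop_nat 1)
  refine tendsto_nhds_unique h1 ?_
  have h2 := (multipliable_qPoch (a * q) hq).hasProd.tendsto_prod_nat.const_mul (1 - a)
  refine h2.congr fun N => ?_
  simp only [Function.comp_apply, Finset.prod_range_succ', pow_zero, mul_one]
  rw [mul_comm]
  congr 1
  exact Finset.prod_congr rfl fun i _ => by ring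

theorem qPoch_mul_qPoch_neg (a : ℂ) {q : ℂ} (hq : ‖q‖ < 1) :
    qPoch a q * qPoch (-a) q = qPoch (a ^ 2) (q ^ 2) := by
  unfold qPoch
  rw [← (multipliable_qPoch a hq).tprod_mul (multipliable_qPoch (-a) hq)]
  exact tprod_congr fun n => by ring

theorem qPoch_mul_qPoch_mul_qPoch {w : ℂ} (hw : w ^ 2 + w + 1 = 0) (a : ℂ) {q : ℂ}
    (hq : ‖q‖ < 1) :
    qPoch a q * qPoch (w * a) q * qPoch (w ^ 2 * a) q = qPoch (a ^ 3) (q ^ 3) := by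
  unfold qPoch
  have h12 := (multipliable_qPoch a hq).mul (multipliable_qPoch (w * a) hq)
  rw [← (multipliable_qPoch a hq).tprod_mul (multipliable_qPoch (w * a) hq),
    ← h12.tprod_mul (multipliable_qPoch (w ^ 2 * a) hq)]
  refine tprod_congr fun n => ?_
  have h3 : (q ^ 3) ^ n = (q ^ n) ^ 3 := by ring
  rw [h3]
  generalize q ^ n = x
  linear_combination (-(a * x) + (w * (a * x) ^ 2) - (w - 1) * (a * x) ^ 3) * hw

theorem qPoch_self_sq_mul {q : ℂ} (hq : ‖q‖ < 1) :
    qPoch q (q ^ 2) * eulerProd (q ^ 2) = eulerProd q := by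
  unfold eulerProd
  rw [qPoch_eq_prod_range q hq two_ne_zero]
  simp [Finset.prod_range_succ, pow_two]

theorem qPoch_neg_self_mul {q : ℂ} (hq : ‖q‖ < 1) :
    qPoch (-q) q * eulerProd q = eulerProd (q ^ 2) := by
  unfold eulerProd
  rw [← qPoch_mul_qPoch_neg q hq, mul_comm]

/-- The odd exponents are those congruent to ±1 modulo 6 and the odd multiples of 3: divide (q;
q²)_∞ by (q³; q⁶)_∞. -/
theorem qPoch_one_five_six {q : ℂ} (hq : ‖q‖ < 1) :
    qPoch q (q ^ 6) * qPoch (q ^ 5) (q ^ 6) * eulerProd (q ^ 6) =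
      eulerProd q * eulerProd (q ^ 6) ^ 2 / (eulerProd (q ^ 2) * eulerProd (q ^ 3)) := by
  have h1 := qPoch_self_sq_mul hq
  have h3 := qPoch_self_sq_mul (norm_pow_lt_one hq three_ne_zero)
  rw [qPoch_eq_prod_range q (norm_pow_lt_one hq two_ne_zero) three_ne_zero] at h1
  simp only [Finset.prod_range_succ, Finset.prod_range_zero, ← pow_mul, ← pow_succ', one_mul,
    mul_zero, mul_one] at h1 h3
  norm_num at h1 h3
  rw [eq_div_iff (mul_ne_zero (eulerProd_pow_ne_zero hq two_ne_zero)
    (eulerProd_pow_ne_zero hq three_ne_zero)), ← h1, ← h3]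
  ring

/-- Likewise, (-q; q)_∞ without its multiples of 3, that is, divided by (-q³; q³)_∞. -/
theorem qPoch_neg_one_two_three {q : ℂ} (hq : ‖q‖ < 1) :
    qPoch (-q) (q ^ 3) * qPoch (-q ^ 2) (q ^ 3) * eulerProd (q ^ 3) =
      eulerProd (q ^ 2) * eulerProd (q ^ 3) ^ 2 / (eulerProd q * eulerProd (q ^ 6)) := by
  have h1 := qPoch_neg_self_mul hq
  have h3 := qPoch_neg_self_mul (norm_pow_lt_one hq three_ne_zero)
  rw [qPoch_eq_prod_range (-q) hq three_ne_zero] at h1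
  simp only [Finset.prod_range_succ, Finset.prod_range_zero, ← pow_mul, ← pow_succ', one_mul,
    neg_mul] at h1 h3
  norm_num at h1 h3
  rw [eq_div_iff (mul_ne_zero (eulerProd_ne_zero hq)
    (eulerProd_pow_ne_zero hq (by norm_num))), ← h1, ← h3]
  ring

/-! ### Theta series and their three-dissections -/

/-- Splitting a series over the integers by residue classes modulo three. -/
theorem HasSum.eq_add_add_of_int {f : ℤ → ℂ} {a x y z : ℂ} (h : HasSum f a)
    (h0 : HasSum (fun m => f (3 * m)) x) (h1 : HasSum (fun m => f (3 * m + 1)) y)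
    (h2 : HasSum (fun m => f (3 * m - 1)) z) : a = x + y + z := by
  -- Here r names the residue class and s the offset used to run through it; they differ only for
  -- the class of -1, where r = 2.
  have key : ∀ {r s : ℤ} {b : ℂ}, HasSum (fun m => f (3 * m + s)) b → (s - r) % 3 = 0 →
      HasSum (fun n => if (n - r) % 3 = 0 then f n else 0) b := by
    intro r s b hb hs
    have hinj : Function.Injective fun m : ℤ => 3 * m + s := fun m m' h => by
      simp only at h; omega
    rw [← hinj.hasSum_iff]
    · refine hb.of_eq (fun m => ?_) rfl
      simp only [Function.comp_apply]
      rw [if_pos (by omega)]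
    · intro n hn
      refine if_neg fun h => hn ⟨(n - s) / 3, ?_⟩
      simp only
      omega
  have k0 := key (r := 0) (s := 0) (by simpa using h0) (by norm_num)
  have k1 := key (r := 1) (s := 1) h1 (by norm_num)
  have k2 := key (r := 2) (s := -1) h2 (by norm_num)
  refine h.unique (((k0.add k1).add k2).of_eq (fun n => ?_) rfl)
  rcases (by omega : n % 3 = 0 ∨ n % 3 = 1 ∨ n % 3 = 2) with h | h | h
  · rw [if_pos (by omega), if_neg (by omega), if_neg (by omega)]; ring
  · rw [if_neg (by omega), if_pos (by omega), if_neg (by omega)]; ring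
  · rw [if_neg (by omega), if_neg (by omega), if_pos (by omega)]; ring

theorem two_mul_mul_sub_one_ediv_two (n : ℤ) : 2 * (n * (n - 1) / 2) = n * (n - 1) :=
  Int.mul_ediv_cancel' ((Int.even_mul_pred_self n).two_dvd)

theorem thetaTerm_mul_pow {t : ℂ} (ht : t ≠ 0) (c : ℂ) (a b : ℕ) (n : ℤ) :
    thetaTerm (c * t ^ a) (t ^ b) n = (-c) ^ n * t ^ (a * n + b * (n * (n - 1) / 2)) := by
  rw [thetaTerm, zpow_add₀ ht, zpow_mul, zpow_mul, zpow_natCast, zpow_natCast, ← neg_mul, mul_zpow]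
  ring

/-- A thinned theta series is again a theta series. -/
theorem thetaTerm_three_mul_add {t c : ℂ} (ht : t ≠ 0) (hc : c ^ 2 = 1) {a b a' b' k : ℕ} {r : ℤ}
    (hb : b' = 9 * b) (ha : (2 : ℤ) * a' = 6 * a + 6 * b * r + 6 * b)
    (hk : (2 : ℤ) * k = 2 * a * r + b * (r * (r - 1))) (m : ℤ) :
    thetaTerm (c * t ^ a) (t ^ b) (3 * m + r) =
      (-c) ^ r * t ^ k * thetaTerm (c * t ^ a') (t ^ b') m := by
  have hc0 : -c ≠ 0 := by
    rintro h
    rw [neg_eq_zero.1 h] at hc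
    norm_num at hc
  -- Both exponents are quadratic in m; doubling removes the integer divisions by two.
  have hexp : (a : ℤ) * (3 * m + r) + b * ((3 * m + r) * (3 * m + r - 1) / 2) =
      k + (a' * m + b' * (m * (m - 1) / 2)) := by
    have e1 := two_mul_mul_sub_one_ediv_two (3 * m + r)
    have e2 := two_mul_mul_sub_one_ediv_two m
    subst hb
    push_cast at *
    refine mul_left_cancel₀ (two_ne_zero (α := ℤ)) ?_
    linear_combination (b : ℤ) * e1 - 9 * b * e2 - hk - m * ha
  have hsign : (-c) ^ (3 * m + r) = (-c) ^ r * (-c) ^ m := by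
    rw [zpow_add₀ hc0, show 3 * m = 2 * m + m by ring, zpow_add₀ hc0, zpow_mul]
    rw [show (-c) ^ (2 : ℤ) = 1 by rw [← hc]; norm_cast; ring, one_zpow]
    ring
  rw [thetaTerm_mul_pow ht, thetaTerm_mul_pow ht, hexp, hsign, zpow_add₀ ht, zpow_natCast]
  ring

/-- The terms are (-1)ⁿ t^(n²): this is φ(-t). -/
theorem hasSum_thetaTerm_phi {t : ℂ} (ht : t ≠ 0) (h1 : ‖t‖ < 1) :
    HasSum (thetaTerm t (t ^ 2)) (eulerProd t ^ 2 / eulerProd (t ^ 2)) := by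
  refine (hasSum_thetaTerm ht (pow_ne_zero 2 ht) (norm_pow_lt_one h1 two_ne_zero)).of_eq
    (fun _ => rfl) ?_
  have h := qPoch_self_sq_mul h1
  rw [div_eq_iff (eulerProd_pow_ne_zero h1 two_ne_zero), ← h, pow_two t, mul_div_cancel_right₀ _ ht]
  unfold eulerProd
  ring

/-- The terms are t^(n(n-1)/2), and n ↦ 1 - n repeats each of them: this is 2ψ(t). In the product
the 2 comes from the first factor, 1 - (-1). -/
theorem hasSum_thetaTerm_psi {t : ℂ} (ht : t ≠ 0) (h1 : ‖t‖ < 1) :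
    HasSum (thetaTerm (-1) t) (2 * (eulerProd (t ^ 2) ^ 2 / eulerProd t)) := by
  refine (hasSum_thetaTerm (neg_ne_zero.2 one_ne_zero) ht h1).of_eq (fun _ => rfl) ?_
  have h := qPoch_neg_self_mul h1
  rw [qPoch_eq_one_sub_mul (-1) h1, ← h, div_neg, div_one, neg_one_mul]
  have := eulerProd_ne_zero h1
  field_simp
  unfold eulerProd
  ring

/-- The parameters t and t⁵ are exchanged by z ↦ t⁶/z, so the products agree. Taken at t³, the two
series are the classes n ≡ ±1 modulo 3 of φ(-t). -/
theorem hasSum_thetaTerm_phi_side {t : ℂ} (ht : t ≠ 0) (h1 : ‖t‖ < 1) :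
    HasSum (thetaTerm t (t ^ 6)) (eulerProd t * eulerProd (t ^ 6) ^ 2 /
      (eulerProd (t ^ 2) * eulerProd (t ^ 3))) ∧
    HasSum (thetaTerm (t ^ 5) (t ^ 6)) (eulerProd t * eulerProd (t ^ 6) ^ 2 /
      (eulerProd (t ^ 2) * eulerProd (t ^ 3))) := by
  have h6 := norm_pow_lt_one h1 (k := 6) (by norm_num)
  rw [← qPoch_one_five_six h1]
  constructor
  · refine (hasSum_thetaTerm ht (pow_ne_zero 6 ht) h6).of_eq (fun _ => rfl) ?_
    rw [show t ^ 6 / t = t ^ 5 by field_simp, eulerProd]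
  · refine (hasSum_thetaTerm (pow_ne_zero 5 ht) (pow_ne_zero 6 ht) h6).of_eq (fun _ => rfl) ?_
    rw [show t ^ 6 / t ^ 5 = t by field_simp, eulerProd]
    ring

theorem hasSum_thetaTerm_psi_side {t : ℂ} (ht : t ≠ 0) (h1 : ‖t‖ < 1) :
    HasSum (thetaTerm (-t) (t ^ 3)) (eulerProd (t ^ 2) * eulerProd (t ^ 3) ^ 2 /
      (eulerProd t * eulerProd (t ^ 6))) ∧
    HasSum (thetaTerm (-t ^ 2) (t ^ 3)) (eulerProd (t ^ 2) * eulerProd (t ^ 3) ^ 2 /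
      (eulerProd t * eulerProd (t ^ 6))) := by
  have h3 := norm_pow_lt_one h1 three_ne_zero
  rw [← qPoch_neg_one_two_three h1]
  constructor
  · refine (hasSum_thetaTerm (neg_ne_zero.2 ht) (pow_ne_zero 3 ht) h3).of_eq (fun _ => rfl) ?_
    rw [show t ^ 3 / -t = -t ^ 2 by field_simp, eulerProd]
  · refine (hasSum_thetaTerm (neg_ne_zero.2 (pow_ne_zero 2 ht)) (pow_ne_zero 3 ht) h3).of_eq
      (fun _ => rfl) ?_
    rw [show t ^ 3 / -t ^ 2 = -t by field_simp, eulerProd]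
    ring

/-- Since (3m)² = 9m², the class n ≡ 0 gives φ(-t⁹); each of the classes ±1 contributes -t times the
side series at t³. -/
theorem phi_three_dissection {t : ℂ} (ht : t ≠ 0) (h1 : ‖t‖ < 1) :
    eulerProd t ^ 2 / eulerProd (t ^ 2) = eulerProd (t ^ 9) ^ 2 / eulerProd (t ^ 18) -
      2 * t * (eulerProd (t ^ 3) * eulerProd (t ^ 18) ^ 2 /
        (eulerProd (t ^ 6) * eulerProd (t ^ 9))) := by
  have h9 := hasSum_thetaTerm_phi (pow_ne_zero 9 ht) (norm_pow_lt_one h1 (k := 9) (by norm_num))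
  obtain ⟨ha, hb⟩ := hasSum_thetaTerm_phi_side (pow_ne_zero 3 ht)
    (norm_pow_lt_one h1 three_ne_zero)
  simp only [← pow_mul] at h9 ha hb
  norm_num at h9 ha hb
  have e0 := thetaTerm_three_mul_add (c := 1) (a := 1) (b := 2) (a' := 9) (b' := 18) (k := 0)
    (r := 0) ht (by norm_num) (by norm_num) (by norm_num) (by norm_num)
  have e1 := thetaTerm_three_mul_add (c := 1) (a := 1) (b := 2) (a' := 15) (b' := 18) (k := 1)
    (r := 1) ht (by norm_num) (by norm_num) (by norm_num) (by norm_num)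
  have e2 := thetaTerm_three_mul_add (c := 1) (a := 1) (b := 2) (a' := 3) (b' := 18) (k := 1)
    (r := -1) ht (by norm_num) (by norm_num) (by norm_num) (by norm_num)
  simp only [one_mul, pow_one, add_zero, ← sub_eq_add_neg] at e0 e1 e2
  rw [(hasSum_thetaTerm_phi ht h1).eq_add_add_of_int (h9.of_eq (fun m => by rw [e0]; simp) rfl)
    ((hb.mul_left (-t)).of_eq (fun m => by rw [e1]; simp) rfl)
    ((ha.mul_left (-t)).of_eq (fun m => by rw [e2]; norm_num) rfl)]
  ring

/-- For the doubled series, n = 3m and n = 3m + 1 give the two side series at t³, and n = 3m - 1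
gives t · 2ψ(t⁹). -/
theorem psi_three_dissection {t : ℂ} (ht : t ≠ 0) (h1 : ‖t‖ < 1) :
    eulerProd (t ^ 2) ^ 2 / eulerProd t = eulerProd (t ^ 6) * eulerProd (t ^ 9) ^ 2 /
      (eulerProd (t ^ 3) * eulerProd (t ^ 18)) +
      t * (eulerProd (t ^ 18) ^ 2 / eulerProd (t ^ 9)) := by
  have h9 := hasSum_thetaTerm_psi (pow_ne_zero 9 ht) (norm_pow_lt_one h1 (k := 9) (by norm_num))
  obtain ⟨ha, hb⟩ := hasSum_thetaTerm_psi_side (pow_ne_zero 3 ht)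
    (norm_pow_lt_one h1 three_ne_zero)
  simp only [← pow_mul] at h9 ha hb
  norm_num at h9 ha hb
  have e0 := thetaTerm_three_mul_add (c := -1) (a := 0) (b := 1) (a' := 3) (b' := 9) (k := 0)
    (r := 0) ht (by norm_num) (by norm_num) (by norm_num) (by norm_num)
  have e1 := thetaTerm_three_mul_add (c := -1) (a := 0) (b := 1) (a' := 6) (b' := 9) (k := 0)
    (r := 1) ht (by norm_num) (by norm_num) (by norm_num) (by norm_num)
  have e2 := thetaTerm_three_mul_add (c := -1) (a := 0) (b := 1) (a' := 0) (b' := 9) (k := 1)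
    (r := -1) ht (by norm_num) (by norm_num) (by norm_num) (by norm_num)
  simp only [neg_one_mul, pow_one, pow_zero, add_zero, ← sub_eq_add_neg] at e0 e1 e2
  refine mul_left_cancel₀ (two_ne_zero (α := ℂ)) ?_
  rw [(hasSum_thetaTerm_psi ht h1).eq_add_add_of_int (ha.of_eq (fun m => by rw [e0]; simp) rfl)
    (hb.of_eq (fun m => by rw [e1]; simp) rfl)
    ((h9.mul_left t).of_eq (fun m => by rw [e2]; norm_num) rfl)]
  ring

/-- The three-dissection of `(q; q)_∞ (q²; q²)_∞`. -/
theorem eulerProd_mul_eulerProd_sq {t : ℂ} (ht : t ≠ 0) (h1 : ‖t‖ < 1) :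
    eulerProd t * eulerProd (t ^ 2) =
      eulerProd (t ^ 6) * eulerProd (t ^ 9) ^ 4 / (eulerProd (t ^ 3) * eulerProd (t ^ 18) ^ 2) -
      t * (eulerProd (t ^ 9) * eulerProd (t ^ 18)) -
      2 * t ^ 2 * (eulerProd (t ^ 3) * eulerProd (t ^ 18) ^ 4 /
        (eulerProd (t ^ 6) * eulerProd (t ^ 9) ^ 2)) := by
  have n1 := eulerProd_ne_zero h1
  have n2 := eulerProd_pow_ne_zero h1 two_ne_zero
  have n3 := eulerProd_pow_ne_zero h1 three_ne_zero
  have n6 := eulerProd_pow_ne_zero h1 (k := 6) (by norm_num)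
  have n9 := eulerProd_pow_ne_zero h1 (k := 9) (by norm_num)
  have n18 := eulerProd_pow_ne_zero h1 (k := 18) (by norm_num)
  -- This is φ(-t)ψ(t). Multiplying the two dissections, the t-terms combine as -2 + 1 = -1.
  have h : eulerProd t * eulerProd (t ^ 2) =
      (eulerProd t ^ 2 / eulerProd (t ^ 2)) * (eulerProd (t ^ 2) ^ 2 / eulerProd t) := by
    field_simp
  rw [h, phi_three_dissection ht h1, psi_three_dissection ht h1]
  field_simp
  ring

/-! ### Extraction of every third coefficient -/

/-- In each factor the multiples of 3 contribute E(t³). In the other two classes the conjugates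
combine by ∏ (1 - wʲx) = 1 - x³, leaving E(t³)/E(t⁹). -/
theorem eulerProd_cube_root_mul {w : ℂ} (hw : w ^ 2 + w + 1 = 0) {t : ℂ} (h1 : ‖t‖ < 1) :
    eulerProd t * eulerProd (w * t) * eulerProd (w ^ 2 * t) =
      eulerProd (t ^ 3) ^ 4 / eulerProd (t ^ 9) := by
  have hw3 : w ^ 3 = 1 := by linear_combination (w - 1) * hw
  have hwn : ‖w‖ = 1 := by
    have := congrArg norm hw3
    rw [norm_pow, norm_one] at this
    exact (pow_eq_one_iff_of_nonneg (norm_nonneg w) three_ne_zero).1 this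
  have h3 := norm_pow_lt_one h1 three_ne_zero
  have tri : ∀ s : ℂ, ‖s‖ < 1 → s ^ 3 = t ^ 3 →
      eulerProd s = qPoch s (t ^ 3) * qPoch (s ^ 2) (t ^ 3) * eulerProd (t ^ 3) := by
    intro s hs hst
    unfold eulerProd
    rw [qPoch_eq_prod_range s hs three_ne_zero, hst]
    simp only [Finset.prod_range_succ, Finset.prod_range_zero, one_mul, ← pow_succ']
    rw [hst, zero_add, pow_one]
  have t0 := tri t h1 rfl
  have t1 := tri (w * t) (by rw [norm_mul, hwn, one_mul]; exact h1) (by rw [mul_pow, hw3, one_mul])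
  have t2 := tri (w ^ 2 * t) (by rw [norm_mul, norm_pow, hwn, one_pow, one_mul]; exact h1)
    (by rw [mul_pow, ← pow_mul, mul_comm 2 3, pow_mul, hw3, one_pow, one_mul])
  have c1 := qPoch_mul_qPoch_mul_qPoch hw t h3
  have c2 := qPoch_mul_qPoch_mul_qPoch hw (t ^ 2) h3
  have t3 : eulerProd (t ^ 3) = qPoch (t ^ 3) ((t ^ 3) ^ 3) * qPoch ((t ^ 2) ^ 3) ((t ^ 3) ^ 3) *
      eulerProd (t ^ 9) := by
    unfold eulerProd
    rw [qPoch_eq_prod_range (t ^ 3) h3 three_ne_zero]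
    simp only [Finset.prod_range_succ, Finset.prod_range_zero, one_mul, pow_zero, mul_one, pow_one]
    ring_nf
  have n9 := eulerProd_pow_ne_zero h1 (k := 9) (by norm_num)
  have e1 : (w * t) ^ 2 = w ^ 2 * t ^ 2 := by ring
  have e2 : (w ^ 2 * t) ^ 2 = w * t ^ 2 := by linear_combination w * t ^ 2 * hw3
  rw [eq_div_iff n9, t0, t1, t2, e1, e2]
  rw [← c1, ← c2] at t3
  linear_combination -(eulerProd (t ^ 3)) ^ 3 * t3

theorem PD_one : PD 1 = 1 := by
  rw [PD_eq_sum, Fintype.sum_unique]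
  simp [Finsupp.prod]

/-- Averaging over the cube roots of unity extracts every third coefficient. -/
theorem HasSum.extract_one_mod_three {w : ℂ} (hw : w ^ 2 + w + 1 = 0) {c : ℕ → ℂ} {t a b d : ℂ}
    (h0 : HasSum (fun n => c n * t ^ n) a) (h1 : HasSum (fun n => c n * (w * t) ^ n) b)
    (h2 : HasSum (fun n => c n * (w ^ 2 * t) ^ n) d) :
    HasSum (fun n => c (3 * n + 1) * t ^ (3 * n + 1)) ((a + w ^ 2 * b + w * d) / 3) := by
  have hw3 : w ^ 3 = 1 := by linear_combination (w - 1) * hw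
  -- The weight 1 + w²·wⁿ + w·w²ⁿ is 3 for n ≡ 1 modulo 3 and 0 otherwise.
  have h := ((h0.add (h1.mul_left (w ^ 2))).add (h2.mul_left w)).div_const 3
  have hinj : Function.Injective fun n : ℕ => 3 * n + 1 := fun m n h => by
    simp only at h; omega
  have h' : HasSum (fun n => if n % 3 = 1 then c n * t ^ n else 0)
      ((a + w ^ 2 * b + w * d) / 3) := by
    refine h.of_eq (fun n => ?_) rfl
    have hm : ∀ k r : ℕ, w ^ (3 * k + r) = w ^ r := fun k r => by
      rw [pow_add, pow_mul, hw3, one_pow, one_mul]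
    have hn : w ^ n = w ^ (n % 3) := by
      conv_lhs => rw [← Nat.div_add_mod n 3]
      exact hm _ _
    rw [mul_pow, mul_pow, ← pow_mul, mul_comm 2 n, pow_mul, hn]
    rcases (by omega : n % 3 = 0 ∨ n % 3 = 1 ∨ n % 3 = 2) with h | h | h <;> rw [h]
    · rw [if_neg (by norm_num)]
      linear_combination -(c n * t ^ n / 3) * hw
    · rw [if_pos rfl]
      linear_combination -(c n * t ^ n / 3) * 2 * hw3
    · rw [if_neg (by norm_num)]
      linear_combination -(c n * t ^ n / 3) * (hw + (w + w ^ 2) * hw3)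
  have h3 := hinj.hasSum_iff (f := fun n => if n % 3 = 1 then c n * t ^ n else 0)
    (a := (a + w ^ 2 * b + w * d) / 3) fun n hn => if_neg fun h => hn ⟨n / 3, by simp only; omega⟩
  refine (h3.2 h').of_eq (fun n => ?_) rfl
  simp only [Function.comp_apply]
  rw [if_pos (by omega)]

theorem exists_primitive_cube_root : ∃ w : ℂ, w ^ 2 + w + 1 = 0 := by
  obtain ⟨s, hs⟩ := IsAlgClosed.exists_pow_nat_eq (-3 : ℂ) two_pos
  exact ⟨(-1 + s) / 2, by linear_combination hs / 4⟩

/-- The generating function of `PD (3 n + 1)` as an eta quotient. -/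
theorem hasSum_PD_three_mul_add_one {q : ℂ} (hq : ‖q‖ < 1) (hq0 : q ≠ 0) :
    HasSum (fun n : ℕ => (PD (3 * n + 1) : ℂ) * q ^ n)
      (4 * q * eulerProd (q ^ 6) ^ 9 /
          (eulerProd q ^ 3 * eulerProd (q ^ 2) ^ 5 * eulerProd (q ^ 3) ^ 3) +
        eulerProd (q ^ 3) ^ 6 / (eulerProd q ^ 6 * eulerProd (q ^ 2) ^ 2)) := by
  obtain ⟨w, hw⟩ := exists_primitive_cube_root
  obtain ⟨t, rfl⟩ := IsAlgClosed.exists_pow_nat_eq q three_pos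
  have ht : t ≠ 0 := fun h => hq0 (by rw [h]; norm_num)
  have h1 : ‖t‖ < 1 := by
    rw [norm_pow] at hq
    exact (pow_lt_one_iff_of_nonneg (norm_nonneg t) three_ne_zero).1 hq
  have hw3 : w ^ 3 = 1 := by linear_combination (w - 1) * hw
  have hwn : ‖w‖ = 1 := by
    have := congrArg norm hw3
    rw [norm_pow, norm_one] at this
    exact (pow_eq_one_iff_of_nonneg (norm_nonneg w) three_ne_zero).1 this
  have hw0 : w ≠ 0 := fun h => by simp [h] at hwn
  have n1 : ‖w * t‖ < 1 := by rw [norm_mul, hwn, one_mul]; exact h1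
  have n2 : ‖w ^ 2 * t‖ < 1 := by rw [norm_mul, norm_pow, hwn, one_pow, one_mul]; exact h1
  -- Functions of t³ are unchanged under t ↦ wt, so only E(t)E(t²) differs between the three
  -- evaluations.
  have p1 : ∀ k, (w * t) ^ (3 * k) = t ^ (3 * k) := fun k => by
    rw [mul_pow, pow_mul, hw3, one_pow, one_mul]
  have p2 : ∀ k, (w ^ 2 * t) ^ (3 * k) = t ^ (3 * k) := fun k => by
    rw [mul_pow, ← pow_mul, mul_left_comm, pow_mul, hw3, one_pow, one_mul]
  have h := (hasSum_PD h1).extract_one_mod_three hw (hasSum_PD n1) (hasSum_PD n2)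
  have d0 := eulerProd_mul_eulerProd_sq ht h1
  have d1 := eulerProd_mul_eulerProd_sq (mul_ne_zero hw0 ht) n1
  have d2 := eulerProd_mul_eulerProd_sq (mul_ne_zero (pow_ne_zero 2 hw0) ht) n2
  have c1 := eulerProd_cube_root_mul hw h1
  have c2 := eulerProd_cube_root_mul hw (norm_pow_lt_one h1 two_ne_zero)
  simp only [show ∀ x, qPoch x x = eulerProd x from fun _ => rfl] at h
  rw [p1 1, p1 2, p2 1, p2 2] at h
  rw [p1 1, p1 2, p1 3, p1 6] at d1
  rw [p2 1, p2 2, p2 3, p2 6] at d2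
  have e1 : (w * t) ^ 2 = w ^ 2 * t ^ 2 := by ring
  have e2 : (w ^ 2 * t) ^ 2 = w * t ^ 2 := by linear_combination w * t ^ 2 * hw3
  rw [e1] at d1 h
  rw [e2] at d2 h
  simp only [← pow_mul] at c2 ⊢
  norm_num at c2 h d1 d2 ⊢
  have nz : ∀ k, k ≠ 0 → eulerProd (t ^ k) ≠ 0 := fun k hk => eulerProd_pow_ne_zero h1 hk
  have z3 := nz 3 (by norm_num)
  have z6 := nz 6 (by norm_num)
  have z9 := nz 9 (by norm_num)
  have z18 := nz 18 (by norm_num)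
  have y0 := mul_ne_zero (eulerProd_ne_zero h1) (nz 2 two_ne_zero)
  have y1 := mul_ne_zero (eulerProd_ne_zero n1) (e1 ▸ eulerProd_pow_ne_zero n1 two_ne_zero)
  have y2 := mul_ne_zero (eulerProd_ne_zero n2) (e2 ▸ eulerProd_pow_ne_zero n2 two_ne_zero)
  have hN : (eulerProd t * eulerProd (t ^ 2)) * (eulerProd (w * t) * eulerProd (w ^ 2 * t ^ 2)) *
      (eulerProd (w ^ 2 * t) * eulerProd (w * t ^ 2)) =
      (eulerProd (t ^ 3) ^ 4 / eulerProd (t ^ 9)) *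
        (eulerProd (t ^ 6) ^ 4 / eulerProd (t ^ 18)) := by
    rw [← c1, ← c2]; ring
  generalize eulerProd t * eulerProd (t ^ 2) = f0 at *
  generalize eulerProd (w * t) * eulerProd (w ^ 2 * t ^ 2) = f1 at *
  generalize eulerProd (w ^ 2 * t) * eulerProd (w * t ^ 2) = f2 at *
  generalize eulerProd (t ^ 3) = E3 at *
  generalize eulerProd (t ^ 6) = E6 at *
  generalize eulerProd (t ^ 9) = E9 at *
  generalize eulerProd (t ^ 18) = E18 at *
  -- With x = tb and y = 2t²c, f1 f2 = a² + x² + y² + ax + ay - xy. The weighted sum keeps three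
  -- times the terms of degree 1 modulo 3 in t, namely ax and y².
  have hnum : f1 * f2 + w ^ 2 * (f0 * f2) + w * (f0 * f1) =
      3 * ((E6 * E9 ^ 4 / (E3 * E18 ^ 2)) * (t * (E9 * E18)) +
        4 * (t ^ 2 * (E3 * E18 ^ 4 / (E6 * E9 ^ 2))) ^ 2) := by
    rw [d0, d1, d2]
    generalize E6 * E9 ^ 4 / (E3 * E18 ^ 2) = a
    generalize E3 * E18 ^ 4 / (E6 * E9 ^ 2) = c
    generalize E9 * E18 = b
    linear_combination (4 * w ^ 2 * t ^ 3 * b * c - w ^ 2 * t * a * b + w ^ 2 * t ^ 2 * b ^ 2 +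
      12 * w * t ^ 4 * c ^ 2 - 4 * w * t ^ 2 * a * c + w * t * a * b - 3 * t * a * b + a ^ 2 -
      12 * t ^ 4 * c ^ 2) * hw
  have hval : (E6 / (f0 * E3) + w ^ 2 * (E6 / (f1 * E3)) + w * (E6 / (f2 * E3))) / 3 =
      t * (4 * t ^ 3 * E18 ^ 9 / (E3 ^ 3 * E6 ^ 5 * E9 ^ 3) + E9 ^ 6 / (E3 ^ 6 * E6 ^ 2)) := by
    have : (E6 / (f0 * E3) + w ^ 2 * (E6 / (f1 * E3)) + w * (E6 / (f2 * E3))) / 3 =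
        E6 / E3 / 3 * ((f1 * f2 + w ^ 2 * (f0 * f2) + w * (f0 * f1)) / (f0 * f1 * f2)) := by
      field_simp
    rw [this, hN, hnum]
    field_simp
    ring
  rw [hval] at h
  refine (h.div_const t).of_eq (fun n => ?_) ?_
  · rw [pow_succ, pow_mul]
    field_simp
  · field_simp

theorem theorem1p6 (q : ℂ) (hq : ‖q‖ < 1) :
    HasSum (fun n : ℕ => (PD (3 * n + 1) : ℂ) * q ^ n)
      (qPoch (q ^ 3) (q ^ 6) ^ 3 * qPoch (q ^ 6) (q ^ 6) ^ 6 /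
          (qPoch q (q ^ 2) ^ 5 * qPoch (q ^ 2) (q ^ 2) ^ 8) *
        (4 * q * (qPoch q (q ^ 2) ^ 2 / qPoch (q ^ 3) (q ^ 6) ^ 6) +
          qPoch (q ^ 3) (q ^ 6) ^ 3 / qPoch q (q ^ 2))) := by
  -- The theta series involve negative powers of q, so q = 0 is treated apart; there both sides
  -- reduce to PD(1) = 1.
  rcases eq_or_ne q 0 with rfl | hq0
  · have h0 : qPoch 0 0 = 1 := by simp [qPoch]
    convert hasSum_single (f := fun n : ℕ => (PD (3 * n + 1) : ℂ) * 0 ^ n) 0 ?_ using 1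
    · simp [h0, PD_one]
    · intro n hn
      simp [hn]
  · refine (hasSum_PD_three_mul_add_one hq hq0).of_eq (fun _ => rfl) ?_
    have z1 := eulerProd_ne_zero hq
    have z2 := eulerProd_pow_ne_zero hq two_ne_zero
    have z3 := eulerProd_pow_ne_zero hq three_ne_zero
    have z6 := eulerProd_pow_ne_zero hq (k := 6) (by norm_num)
    -- With (q; q²)_∞ = E₁/E₂ and (q³; q⁶)_∞ = E₃/E₆ the stated form becomes the eta quotient.
    have a1 := eq_div_of_mul_eq z2 (qPoch_self_sq_mul hq)
    have a3 := qPoch_self_sq_mul (norm_pow_lt_one hq three_ne_zero)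
    rw [← pow_mul] at a3
    have a3' := eq_div_of_mul_eq z6 a3
    norm_num at a3'
    rw [a1, a3', ← eulerProd, ← eulerProd]
    field_simp
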